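/- Let $\rho = 1+\sqrt2$. The silver stepsize schedules $\pi^{(m)} = (\pi^{(m)}_0,\dots,\pi^{(m)}_{2^m-2})$, $m\ge 1$, are defined by $\pi^{(1)} = [\sqrt 2]$ and $\pi^{(m+1)} = [\pi^{(m)},\, 1+\rho^{m-1},\, \pi^{(m)}]$ (concatenation). Call $h:\mathbb{R}^d\to\mathbb{R}$ $L$-smooth if it is differentiable and $\|\nabla h(x)-\nabla h(y)\|\le L\|x-y\|$ for all $x,y\in\mathbb{R}^d$, where $\|\cdot\|$ is the Euclidean norm. Let $m\ge 1$, $N = 2^m-1$, $d \ge 0$ and $L>0$. Let $h:\mathbb{R}^d\to\mathbb{R}$ be any $L$-smooth convex function, $x^\star$ any minimizer of $h$, $x^0\in\mathbb{R}^d$ any initial point, and let $x^1,\dots,x^N$ be given by gradient descent with the silver schedule, $$x^{k+1} = x^k - \frac{\pi^{(m)}_k}{L}\nabla h(x^k),\qquad k=0,\dots,N-1 .$$ Then $$h(x^N)-h(x^\star)\le \frac{L\|x^0-x^\star\|^2}{2\bigl(2\sum_{i=0}^{2^m-2}\pi^{(m)}_i+1\bigr)} = \frac{L\|x^0-x^\star\|^2}{4\rho^m-2},$$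 $$\|\nabla h(x^N)\|\le \frac{L\|x^0-x^\star\|}{\sum_{i=0}^{2^m-2}\pi^{(m)}_i+1} = \frac{L\|x^0-x^\star\|}{\rho^m}.$$ Furthermore, both bounds are tight: for all $m\ge1$, $d$, $L>0$ as above and all $x^0\neq x^\star$ in $\mathbb{R}^d$, there is an $L$-smooth convex function $h:\mathbb{R}^d\to\mathbb{R}$ with minimizer $x^\star$ for which the first bound holds with equality, and there is (possibly another) such function for which the second bound holds with equality. -/

import Mathlib

/-- The silver ratio `ρ = 1 + √2`. -/
noncomputable def silverRatio : ℝ := 1 + Real.sqrt 2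

/-- The silver stepsize schedule `π^(m)`: `π^(1) = [√2]` and
`π^(m+1) = [π^(m), 1 + ρ^(m-1), π^(m)]` for `m ≥ 1`.
(The schedule is only considered for `m ≥ 1`; the value at `0` is the empty schedule.) -/
noncomputable def silverSchedule : ℕ → List ℝ
  | 0 => []
  | 1 => [Real.sqrt 2]
  | m + 2 => silverSchedule (m + 1) ++ [1 + silverRatio ^ m] ++ silverSchedule (m + 1)

/-- The schedule `π^(m)` has `2^m - 1` entries. -/
theorem silverSchedule_length (m : ℕ) : (silverSchedule m).length = 2 ^ m - 1 := by
  induction m using silverSchedule.induct with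
  | case1 => simp [silverSchedule]
  | case2 => simp [silverSchedule]
  | case3 m ih =>
    have h : 0 < 2 ^ m := by positivity
    simp only [silverSchedule, List.length_append, List.length_cons, List.length_nil, ih]
    rw [pow_succ 2 (m + 1), pow_succ 2 m]
    omega

/-- `h` is `L`-smooth on `ℝ^d`: it is differentiable and its gradient is Lipschitz continuous
with constant `L` with respect to the Euclidean norm. -/
def IsLSmooth {d : ℕ} (L : ℝ) (h : EuclideanSpace ℝ (Fin d) → ℝ) : Prop :=
  Differentiable ℝ h ∧ ∀ x y, ‖gradient h x - gradient h y‖ ≤ L * ‖x - y‖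

/-- The points `x 0, …, x N` are the iterates of the `N`-step gradient descent method on `h`,
started at `x₀`, with stepsizes `α` normalized by `L`, where `N` is the length of `α`:
`x 0 = x₀` and `x (k+1) = x k - (α_k / L) ∇h(x k)` for `k = 0, …, N - 1`.
(Values of `x` beyond the index `N` play no role.) -/
def IsGradientDescent {d : ℕ} (L : ℝ) (h : EuclideanSpace ℝ (Fin d) → ℝ) (α : List ℝ)
    (x₀ : EuclideanSpace ℝ (Fin d)) (x : ℕ → EuclideanSpace ℝ (Fin d)) : Prop :=
  x 0 = x₀ ∧ ∀ (k : ℕ) (hk : k < α.length), x (k + 1) = x k - (α[k] / L) • gradient h (x k)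

/-!
A function `f` is convex and `1`-smooth with gradient `g` exactly when `(f, g)` satisfies the
interpolation inequality `f y + ⟪g y, x - y⟫ + ‖g x - g y‖ ^ 2 / 2 ≤ f x`, and dividing by `L`
reduces everything to this case. For steps of sum `S` leading from `a` to `b`, one strengthens the
two rates to the bound
`‖b - y⁺‖ ^ 2 + S * (S + 1) * ‖g b‖ ^ 2 + 2 * S * (f b - f y + ‖g y‖ ^ 2 / 2) ≤ ‖a - y⁺‖ ^ 2`,
`y⁺ = y - g y`, for *every* reference point `y`. This freedom makes it inductive: when two copies of
a schedule are joined by the step `1 + r`, the bound of the second copy is used not only at `y` but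
also at both of its end points, and the resulting inequalities add up exactly if `S + 1 = ρ * r`
with `ρ ^ 2 = 2 * ρ + 1`. Taking for `y` a minimizer gives the rates.

Both rates are attained by Huber functions of the distance to the minimizer, with a threshold small
enough that all iterates stay on the linear part of the function.
-/

section Interpolation

open scoped RealInnerProductSpace Gradient

variable {E : Type*} [NormedAddCommGroup E] [InnerProductSpace ℝ E] {f : E → ℝ} {g : E → E}

/-- The interpolation inequality `f y + ⟪g y, x - y⟫ + ‖g x - g y‖ ^ 2 / 2 ≤ f x` between a
function and a vector field. It characterizes the `1`-smooth convex functions `f` with gradient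
`g`, and it is the only property of the objective that the rates use. -/
def IsInterpolable (f : E → ℝ) (g : E → E) : Prop :=
  ∀ x y, f y + ⟪g y, x - y⟫ + ‖g x - g y‖ ^ 2 / 2 ≤ f x

theorem IsInterpolable.comp_sub_const (hfg : IsInterpolable f g) (c : E) :
    IsInterpolable (fun x => f (x - c)) (fun x => g (x - c)) := by
  intro x y
  simpa only [sub_sub_sub_cancel_right] using hfg (x - c) (y - c)

theorem IsInterpolable.add_inner_le (hfg : IsInterpolable f g) (x y : E) :
    f y + ⟪g y, x - y⟫ ≤ f x := by
  linarith [hfg x y, sq_nonneg ‖g x - g y‖]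

theorem IsInterpolable.norm_sub_sq_le_inner (hfg : IsInterpolable f g) (x y : E) :
    ‖g x - g y‖ ^ 2 ≤ ⟪g x - g y, x - y⟫ := by
  have hyx := hfg y x
  rw [← neg_sub x y, inner_neg_right, norm_sub_rev] at hyx
  rw [inner_sub_left]
  linarith [hfg x y]

theorem IsInterpolable.norm_sub_le (hfg : IsInterpolable f g) (x y : E) :
    ‖g x - g y‖ ≤ ‖x - y‖ := by
  have hsq : ‖g x - g y‖ * ‖g x - g y‖ ≤ ‖g x - g y‖ * ‖x - y‖ := by
    rw [← sq]
    exact (hfg.norm_sub_sq_le_inner x y).trans (real_inner_le_norm _ _)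
  rcases (norm_nonneg (g x - g y)).eq_or_lt with hzero | hpos
  · exact hzero ▸ norm_nonneg _
  · exact le_of_mul_le_mul_left hsq hpos

theorem IsInterpolable.convexOn (hfg : IsInterpolable f g) : ConvexOn ℝ Set.univ f := by
  refine ⟨convex_univ, fun x _ y _ a b ha hb hab => ?_⟩
  set z := a • x + b • y with hz
  have hbarycenter : a * ⟪g z, x - z⟫ + b * ⟪g z, y - z⟫ = 0 := by
    rw [← real_inner_smul_right, ← real_inner_smul_right, ← inner_add_right, smul_sub, smul_sub,
      sub_add_sub_comm, ← hz, ← add_smul, hab, one_smul, sub_self, inner_zero_right]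
  calc f z = a * (f z + ⟪g z, x - z⟫) + b * (f z + ⟪g z, y - z⟫) := by
        linear_combination -hbarycenter - f z * hab
    _ ≤ a * f x + b * f y := by gcongr <;> exact hfg.add_inner_le _ _

theorem IsInterpolable.hasGradientAt [CompleteSpace E] (hfg : IsInterpolable f g) (x : E) :
    HasGradientAt f (g x) x := by
  rw [hasGradientAt_iff_isLittleO]
  suffices hquad : (fun z => f z - f x - ⟪g x, z - x⟫) =O[nhds x] fun z => ‖z - x‖ ^ 2 from
    hquad.trans_isLittleO (Asymptotics.isLittleO_pow_sub_sub x one_lt_two)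
  refine Asymptotics.IsBigO.of_bound 1 (Filter.Eventually.of_forall fun z => ?_)
  have hupper : ⟪g z - g x, z - x⟫ ≤ ‖z - x‖ ^ 2 := calc
    ⟪g z - g x, z - x⟫ ≤ ‖g z - g x‖ * ‖z - x‖ := real_inner_le_norm _ _
    _ ≤ ‖z - x‖ ^ 2 := by rw [sq]; gcongr; exact hfg.norm_sub_le z x
  have hxz := hfg.add_inner_le x z
  rw [← neg_sub z x, inner_neg_right] at hxz
  rw [inner_sub_left] at hupper
  rw [Real.norm_of_nonneg (by linarith [hfg.add_inner_le z x]), Real.norm_of_nonneg (sq_nonneg _)]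
  linarith

theorem gradient_eq_zero_of_isLocalMin [CompleteSpace E] {x : E} (hx : IsLocalMin f x) :
    ∇ f x = 0 := by
  rw [gradient, hx.fderiv_eq_zero, map_zero]

theorem add_inner_le_of_convexOn_of_hasGradientAt [CompleteSpace E] {s : Set E}
    (hf : ConvexOn ℝ s f) {v x y : E} (hx : x ∈ s) (hy : y ∈ s) (hv : HasGradientAt f v x) :
    f x + ⟪v, y - x⟫ ≤ f y := by
  have hconv := hf.comp_affineMap (AffineMap.lineMap x y : ℝ →ᵃ[ℝ] E)
  have hderiv : HasDerivAt (f ∘ AffineMap.lineMap x y) ⟪v, y - x⟫ (0 : ℝ) := by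
    rw [← AffineMap.lineMap_apply_zero (k := ℝ) x y] at hv
    exact hv.hasFDerivAt.comp_hasDerivAt 0 AffineMap.hasDerivAt_lineMap
  have hslope := hconv.le_slope_of_hasDerivAt (x := 0) (y := 1) (by simpa using hx)
    (by simpa using hy) zero_lt_one hderiv
  simp only [slope_def_field, Function.comp_apply, AffineMap.lineMap_apply_zero,
    AffineMap.lineMap_apply_one, sub_zero, div_one] at hslope
  linarith

end Interpolation

section Smooth

open scoped RealInnerProductSpace Gradient

variable {E : Type*} [NormedAddCommGroup E] [InnerProductSpace ℝ E] [CompleteSpace E]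
  {L : ℝ} {f h : E → ℝ} {g : E → E}

/-- `L`-smoothness on a real Hilbert space: the extension of `IsLSmooth` to infinite dimension. -/
def HasLipschitzGradient (L : ℝ) (h : E → ℝ) : Prop :=
  Differentiable ℝ h ∧ ∀ x y, ‖∇ h x - ∇ h y‖ ≤ L * ‖x - y‖

/-- Gradient descent on a real Hilbert space with stepsizes `α` normalized by `L`: the extension of
`IsGradientDescent` to infinite dimension. -/
def IsGradientDescentFrom (L : ℝ) (h : E → ℝ) (α : List ℝ) (x₀ : E) (x : ℕ → E) : Prop :=
  x 0 = x₀ ∧ ∀ (k : ℕ) (hk : k < α.length), x (k + 1) = x k - (α[k] / L) • ∇ h (x k)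

theorem HasLipschitzGradient.le_add_inner_add_sq (hh : HasLipschitzGradient L h) (x y : E) :
    h y ≤ h x + ⟪∇ h x, y - x⟫ + L / 2 * ‖y - x‖ ^ 2 := by
  let γ : ℝ → E := AffineMap.lineMap x y
  have hγ (t : ℝ) : HasDerivAt (h ∘ γ) ⟪∇ h (γ t), y - x⟫ t :=
    (hh.1 (γ t)).hasGradientAt.hasFDerivAt.comp_hasDerivAt t AffineMap.hasDerivAt_lineMap
  have hquad (t : ℝ) : HasDerivAt
      (fun s => h x + s * ⟪∇ h x, y - x⟫ + L / 2 * ‖y - x‖ ^ 2 * s ^ 2)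
      (⟪∇ h x, y - x⟫ + L * ‖y - x‖ ^ 2 * t) t := by
    refine ((((hasDerivAt_id t).mul_const ⟪∇ h x, y - x⟫).const_add (h x)).add
      ((hasDerivAt_pow 2 t).const_mul (L / 2 * ‖y - x‖ ^ 2))).congr_deriv ?_
    norm_num
    ring
  have hderiv_le (t : ℝ) (ht : 0 ≤ t) :
      ⟪∇ h (γ t), y - x⟫ ≤ ⟪∇ h x, y - x⟫ + L * ‖y - x‖ ^ 2 * t := by
    rw [← sub_le_iff_le_add', ← inner_sub_left]
    calc ⟪∇ h (γ t) - ∇ h x, y - x⟫ ≤ ‖∇ h (γ t) - ∇ h x‖ * ‖y - x‖ := real_inner_le_norm _ _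
      _ ≤ L * ‖γ t - x‖ * ‖y - x‖ := by gcongr; exact hh.2 _ _
      _ = L * ‖y - x‖ ^ 2 * t := by
        rw [← vsub_eq_sub (γ t), AffineMap.lineMap_vsub_left, vsub_eq_sub, norm_smul,
          Real.norm_of_nonneg ht]
        ring
  have hle := image_le_of_deriv_right_le_deriv_boundary (a := 0) (b := 1)
    (fun t _ => (hγ t).continuousAt.continuousWithinAt) (fun t _ => (hγ t).hasDerivWithinAt)
    (by simp [γ]) (fun t _ => (hquad t).continuousAt.continuousWithinAt)
    (fun t _ => (hquad t).hasDerivWithinAt) (fun t ht => hderiv_le t ht.1)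
    (Set.right_mem_Icc.2 zero_le_one)
  simpa only [γ, Function.comp_apply, AffineMap.lineMap_apply_one, one_mul, one_pow, mul_one]
    using hle

theorem HasLipschitzGradient.add_inner_add_sq_le (hh : HasLipschitzGradient L h) (hL : 0 < L)
    (hconv : ConvexOn ℝ Set.univ h) (x y : E) :
    h y + ⟪∇ h y, x - y⟫ + ‖∇ h x - ∇ h y‖ ^ 2 / (2 * L) ≤ h x := by
  -- Compare the lower bound from `y` and the upper bound from `x` where they are closest.
  set w := ∇ h x - ∇ h y
  set z := x - L⁻¹ • w with hz
  have hlower : h y + ⟪∇ h y, z - y⟫ ≤ h z :=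
    add_inner_le_of_convexOn_of_hasGradientAt hconv (Set.mem_univ y) (Set.mem_univ z)
      (hh.1 y).hasGradientAt
  have hupper := hh.le_add_inner_add_sq x z
  have hzx : z - x = -(L⁻¹ • w) := by rw [hz]; abel
  have hzy : z - y = (x - y) - L⁻¹ • w := by rw [hz]; abel
  have hww : ⟪∇ h x, w⟫ - ⟪∇ h y, w⟫ = ‖w‖ ^ 2 := by
    rw [← inner_sub_left, real_inner_self_eq_norm_sq]
  rw [hzy, inner_sub_right, real_inner_smul_right] at hlower
  rw [hzx, inner_neg_right, real_inner_smul_right, norm_neg, norm_smul, mul_pow,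
    Real.norm_eq_abs, sq_abs] at hupper
  calc h y + ⟪∇ h y, x - y⟫ + ‖w‖ ^ 2 / (2 * L)
      ≤ h x + L⁻¹ * ⟪∇ h y, w⟫ - L⁻¹ * ⟪∇ h x, w⟫
          + L / 2 * (L⁻¹ ^ 2 * ‖w‖ ^ 2) + ‖w‖ ^ 2 / (2 * L) := by linarith
    _ = h x := by
      field_simp
      linear_combination -2 * hww

theorem HasLipschitzGradient.isInterpolable (hh : HasLipschitzGradient L h) (hL : 0 < L)
    (hconv : ConvexOn ℝ Set.univ h) :
    IsInterpolable (fun x => L⁻¹ * h x) (fun x => L⁻¹ • ∇ h x) := by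
  intro x y
  calc L⁻¹ * h y + ⟪L⁻¹ • ∇ h y, x - y⟫ + ‖L⁻¹ • ∇ h x - L⁻¹ • ∇ h y‖ ^ 2 / 2
      = L⁻¹ * (h y + ⟪∇ h y, x - y⟫ + ‖∇ h x - ∇ h y‖ ^ 2 / (2 * L)) := by
        rw [← smul_sub, norm_smul, real_inner_smul_left, mul_pow, Real.norm_eq_abs, sq_abs]
        field_simp
    _ ≤ L⁻¹ * h x := by gcongr; exact hh.add_inner_add_sq_le hL hconv x y

theorem IsInterpolable.hasGradientAt_const_mul (hfg : IsInterpolable f g) (c : ℝ) (x : E) :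
    HasGradientAt (fun z => c * f z) (c • g x) x := by
  rw [hasGradientAt_iff_hasFDerivAt, map_smul]
  exact (hfg.hasGradientAt x).hasFDerivAt.const_mul c

theorem IsInterpolable.hasLipschitzGradient_const_mul (hfg : IsInterpolable f g) (hL : 0 ≤ L) :
    HasLipschitzGradient L (fun z => L * f z) := by
  refine ⟨fun x => (hfg.hasGradientAt_const_mul L x).differentiableAt, fun x y => ?_⟩
  rw [(hfg.hasGradientAt_const_mul L x).gradient, (hfg.hasGradientAt_const_mul L y).gradient,
    ← smul_sub, norm_smul, Real.norm_of_nonneg hL]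
  gcongr
  exact hfg.norm_sub_le x y

end Smooth

section Potential

open scoped RealInnerProductSpace

variable {E : Type*} [NormedAddCommGroup E] [InnerProductSpace ℝ E] {f : E → ℝ} {g : E → E}
  {l l₁ l₂ : List ℝ} {x : ℕ → E}

/-- The points `x 0, …, x l.length` arise by stepping against the vector field `g` with stepsizes
`l`. The starting point is left free so that paths can be cut into pieces. -/
def IsDescentPath (g : E → E) (l : List ℝ) (x : ℕ → E) : Prop :=
  ∀ (k : ℕ) (hk : k < l.length), x (k + 1) = x k - l[k] • g (x k)

/-- The inductive invariant of the silver schedule: a descent path with stepsizes `l` of sum `S`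
from `a` to `b` satisfies, for every reference point `y` and with `y⁺ = y - g y`,
`‖b - y⁺‖ ^ 2 + S * (S + 1) * ‖g b‖ ^ 2 + 2 * S * (f b - f y + ‖g y‖ ^ 2 / 2) ≤ ‖a - y⁺‖ ^ 2`. -/
def HasPotentialBound (f : E → ℝ) (g : E → E) (l : List ℝ) : Prop :=
  ∀ x : ℕ → E, IsDescentPath g l x → ∀ y : E,
    ‖x l.length - (y - g y)‖ ^ 2 + l.sum * (l.sum + 1) * ‖g (x l.length)‖ ^ 2
      + 2 * l.sum * (f (x l.length) - f y + ‖g y‖ ^ 2 / 2) ≤ ‖x 0 - (y - g y)‖ ^ 2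

theorem IsDescentPath.of_append_left (hx : IsDescentPath g (l₁ ++ l₂) x) :
    IsDescentPath g l₁ x := by
  intro k hk
  rw [hx k (by rw [List.length_append]; omega), List.getElem_append_left hk]

theorem IsDescentPath.of_append_right (hx : IsDescentPath g (l₁ ++ l₂) x) :
    IsDescentPath g l₂ (fun k => x (l₁.length + k)) := by
  intro k hk
  have hstep := hx (l₁.length + k) (by rw [List.length_append]; omega)
  simpa [add_assoc] using hstep

theorem IsInterpolable.norm_step_sub_sq_le (hfg : IsInterpolable f g) {t : ℝ} (ht : 0 ≤ t)
    (a y : E) :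
    ‖a - t • g a - (y - g y)‖ ^ 2 ≤ ‖a - (y - g y)‖ ^ 2
      - 2 * t * (f a - f y + ‖g y‖ ^ 2 / 2) + t * (t - 1) * ‖g a‖ ^ 2 := by
  have hinner : f a - f y + ‖g a‖ ^ 2 / 2 + ‖g y‖ ^ 2 / 2 ≤ ⟪g a, a - (y - g y)⟫ := by
    have hya := hfg y a
    rw [norm_sub_sq_real, inner_sub_right] at hya
    rw [inner_sub_right, inner_sub_right]
    linarith [real_inner_comm (g a) (g y)]
  calc ‖a - t • g a - (y - g y)‖ ^ 2
      = ‖a - (y - g y)‖ ^ 2 - 2 * t * ⟪g a, a - (y - g y)⟫ + t ^ 2 * ‖g a‖ ^ 2 := by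
        rw [sub_right_comm, norm_sub_sq_real, real_inner_smul_right, real_inner_comm, norm_smul,
          mul_pow, Real.norm_eq_abs, sq_abs]
        ring
    _ ≤ ‖a - (y - g y)‖ ^ 2
          - 2 * t * (f a - f y + ‖g a‖ ^ 2 / 2 + ‖g y‖ ^ 2 / 2) + t ^ 2 * ‖g a‖ ^ 2 := by gcongr
    _ = _ := by ring

/- In a join of two copies of a schedule, `a` ends the first copy and `b` the second. The invariant
of the second copy is used here with the reference points `a` and `b` themselves. -/
theorem IsInterpolable.decrease_of_potential_le (hfg : IsInterpolable f g) {S r : ℝ} (hr : 0 ≤ r)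
    {a b : E} (hb : ∀ y, ‖b - (y - g y)‖ ^ 2 + S * (S + 1) * ‖g b‖ ^ 2
      + 2 * S * (f b - f y + ‖g y‖ ^ 2 / 2) ≤ ‖a - (1 + r) • g a - (y - g y)‖ ^ 2) :
    (2 * S * (S + 1) + S + 1 + r) * ‖g b‖ ^ 2 + 2 * (S + 1 - r) * (f b - f a)
      ≤ (2 * r ^ 2 + r - (S + 1)) * ‖g a‖ ^ 2 := by
  obtain ⟨w, hw⟩ : ∃ w, b = a - g a - w := ⟨a - g a - b, by abel⟩
  have hrefa : ‖w‖ ^ 2 + S * (S + 1) * ‖g b‖ ^ 2 + 2 * S * (f b - f a + ‖g a‖ ^ 2 / 2)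
      ≤ r ^ 2 * ‖g a‖ ^ 2 := by
    have h := hb a
    rwa [show b - (a - g a) = -w by rw [hw]; abel,
      show a - (1 + r) • g a - (a - g a) = -(r • g a) by module, norm_neg, norm_neg, norm_smul,
      mul_pow, Real.norm_eq_abs, sq_abs] at h
  have hrefb : S * (S + 2) * ‖g b‖ ^ 2 ≤ ‖w‖ ^ 2 + r ^ 2 * ‖g a‖ ^ 2
      + 2 * ⟪g b, w⟫ - 2 * r * ⟪g a, w⟫ - 2 * r * ⟪g a, g b⟫ := by
    have h := hb b
    rw [sub_sub_cancel, show a - (1 + r) • g a - (b - g b) = w - r • g a + g b by rw [hw]; module,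
      norm_add_sq_real, norm_sub_sq_real, inner_sub_left, real_inner_smul_left,
      real_inner_smul_right, norm_smul, mul_pow, Real.norm_eq_abs, sq_abs,
      real_inner_comm (g a) w, real_inner_comm (g b) w] at h
    linarith
  have hgb : ⟪g b, w⟫ ≤ f a - f b - ‖g a‖ ^ 2 / 2 - ‖g b‖ ^ 2 / 2 := by
    have h := hfg a b
    rw [show a - b = w + g a by rw [hw]; abel, inner_add_right, norm_sub_sq_real] at h
    linarith [real_inner_comm (g a) (g b)]
  have hga : -⟪g a, w⟫ ≤ f b - f a + ‖g a‖ ^ 2 / 2 - ‖g b‖ ^ 2 / 2 + ⟪g a, g b⟫ := by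
    have h := hfg b a
    rw [show b - a = -(w + g a) by rw [hw]; abel, inner_neg_right, inner_add_right,
      real_inner_self_eq_norm_sq, norm_sub_sq_real] at h
    linarith [real_inner_comm (g a) (g b)]
  linarith [mul_le_mul_of_nonneg_left hga hr]

/- The comparison of the two ends must enter with weight `(S + 1 + r) / (S + 1 - r)`, `S = l.sum`;
for `S + 1 = ρ * r` this is `(ρ + 1) / (ρ - 1)`, which equals `ρ` because `ρ ^ 2 = 2 * ρ + 1`. -/
theorem HasPotentialBound.append_singleton_append (hl : HasPotentialBound f g l)
    (hfg : IsInterpolable f g) {ρ r : ℝ} (hρ : ρ ^ 2 = 2 * ρ + 1) (hρ₀ : 0 ≤ ρ) (hr : 0 ≤ r)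
    (hsum : l.sum + 1 = ρ * r) : HasPotentialBound f g (l ++ [1 + r] ++ l) := by
  intro x hx y
  have hfirst := hl x hx.of_append_left.of_append_left y
  have hsecond := hl _ hx.of_append_right
  have hmiddle := hx.of_append_left l.length (by simp)
  simp only [List.length_append, List.length_singleton, add_zero, List.getElem_concat_length]
    at hmiddle hsecond
  rw [hmiddle] at hsecond
  have hstep := hfg.norm_step_sub_sq_le (add_nonneg zero_le_one hr) (x l.length) y
  have hdecrease := mul_le_mul_of_nonneg_left (hfg.decrease_of_potential_le hr hsecond) hρ₀
  simp only [List.length_append, List.length_singleton, List.sum_append, List.sum_singleton]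
  set S := l.sum
  have hS : S = ρ * r - 1 := eq_sub_of_add_eq hsum
  have hvalue : ρ * (2 * (S + 1 - r)) = 2 * (S + 1 + r) := by
    rw [hS]; linear_combination 2 * r * hρ
  have hend : ρ * (2 * S * (S + 1) + S + 1 + r)
      = (S + (1 + r) + S) * (S + (1 + r) + S + 1) - S * (S + 1) := by
    rw [hS]; linear_combination ((2 * ρ + 1) * r ^ 2 - r) * hρ
  have hstart : ρ * (2 * r ^ 2 + r - (S + 1)) = S * (S + 1) - (1 + r) * (1 + r - 1) := by
    rw [hS]; linear_combination -(r ^ 2 + r) * hρ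
  linear_combination hfirst + hsecond y + hstep + hdecrease
    - (f (x (l.length + 1 + l.length)) - f (x l.length)) * hvalue
    - ‖g (x (l.length + 1 + l.length))‖ ^ 2 * hend + ‖g (x l.length)‖ ^ 2 * hstart

theorem HasPotentialBound.value_rate (hl : HasPotentialBound f g l) (hfg : IsInterpolable f g)
    (hsum : 0 ≤ l.sum) (hx : IsDescentPath g l x) {y : E} (hy : g y = 0) :
    2 * (2 * l.sum + 1) * (f (x l.length) - f y) ≤ ‖x 0 - y‖ ^ 2 := by
  set S := l.sum
  set b := x l.length
  have hpot : ‖b - y‖ ^ 2 + S * (S + 1) * ‖g b‖ ^ 2 + 2 * S * (f b - f y) ≤ ‖x 0 - y‖ ^ 2 := by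
    simpa [hy] using hl x hx y
  have hgap : f b - f y ≤ ⟪g b, b - y⟫ - ‖g b‖ ^ 2 / 2 := by
    have h := hfg y b
    rw [hy, zero_sub, norm_neg, ← neg_sub b y, inner_neg_right] at h
    linarith
  have hyoung : 2 * (S + 1) * ⟪g b, b - y⟫ ≤ ‖b - y‖ ^ 2 + (S + 1) ^ 2 * ‖g b‖ ^ 2 := by
    nlinarith [sq_nonneg (‖b - y‖ - (S + 1) * ‖g b‖), real_inner_le_norm (g b) (b - y)]
  linarith [mul_le_mul_of_nonneg_left hgap (by positivity : 0 ≤ 2 * (S + 1))]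

theorem HasPotentialBound.gradient_rate (hl : HasPotentialBound f g l) (hfg : IsInterpolable f g)
    (hsum : 0 ≤ l.sum) (hx : IsDescentPath g l x) {y : E} (hy : g y = 0) :
    (l.sum + 1) * ‖g (x l.length)‖ ≤ ‖x 0 - y‖ := by
  set S := l.sum
  set b := x l.length
  have hpot : ‖b - y‖ ^ 2 + S * (S + 1) * ‖g b‖ ^ 2 + 2 * S * (f b - f y) ≤ ‖x 0 - y‖ ^ 2 := by
    simpa [hy] using hl x hx y
  have hgap : ‖g b‖ ^ 2 / 2 ≤ f b - f y := by
    have h := hfg b y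
    rw [hy, inner_zero_left, sub_zero] at h
    linarith
  have hdist : ‖g b‖ ≤ ‖b - y‖ := by simpa [hy] using hfg.norm_sub_le b y
  refine le_of_sq_le_sq ?_ (norm_nonneg _)
  calc ((S + 1) * ‖g b‖) ^ 2
      = ‖g b‖ ^ 2 + S * (S + 1) * ‖g b‖ ^ 2 + 2 * S * (‖g b‖ ^ 2 / 2) := by ring
    _ ≤ ‖b - y‖ ^ 2 + S * (S + 1) * ‖g b‖ ^ 2 + 2 * S * (f b - f y) := by gcongr
    _ ≤ ‖x 0 - y‖ ^ 2 := hpot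

end Potential

section Silver

theorem silverRatio_pos : 0 < silverRatio := by
  unfold silverRatio
  positivity

theorem one_le_silverRatio : 1 ≤ silverRatio :=
  le_add_of_nonneg_right (Real.sqrt_nonneg 2)

theorem silverRatio_sq : silverRatio ^ 2 = 2 * silverRatio + 1 := by
  have hsqrt : √(2 : ℝ) ^ 2 = 2 := Real.sq_sqrt zero_le_two
  unfold silverRatio
  linear_combination hsqrt

theorem one_add_inv_silverRatio : 1 + silverRatio⁻¹ = √2 := by
  have hinv : silverRatio⁻¹ = silverRatio - 2 := by
    refine inv_eq_of_mul_eq_one_right ?_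
    linear_combination silverRatio_sq
  rw [hinv, silverRatio]
  ring

theorem silverSchedule_succ (m : ℕ) : silverSchedule (m + 1) =
    silverSchedule m ++ [1 + silverRatio ^ m / silverRatio] ++ silverSchedule m := by
  cases m with
  | zero => simp [silverSchedule, one_add_inv_silverRatio]
  | succ m => rw [silverSchedule, pow_succ, mul_div_cancel_right₀ _ silverRatio_pos.ne']

theorem sum_silverSchedule_add_one (m : ℕ) : (silverSchedule m).sum + 1 = silverRatio ^ m := by
  induction m with
  | zero => simp [silverSchedule]
  | succ m ih =>
    have hρ : silverRatio ^ m * silverRatio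
        = 2 * silverRatio ^ m + silverRatio ^ m / silverRatio := by
      field_simp [silverRatio_pos.ne']
      linear_combination silverRatio_sq
    rw [silverSchedule_succ, List.sum_append, List.sum_append, List.sum_singleton, pow_succ, hρ]
    linear_combination 2 * ih

theorem sum_silverSchedule_nonneg (m : ℕ) : 0 ≤ (silverSchedule m).sum := by
  linarith [sum_silverSchedule_add_one m, one_le_pow₀ (n := m) one_le_silverRatio]

theorem silverSchedule_nonneg (m : ℕ) : ∀ a ∈ silverSchedule m, 0 ≤ a := by
  induction m with
  | zero => simp [silverSchedule]
  | succ m ih =>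
    have hmiddle : 0 ≤ 1 + silverRatio ^ m / silverRatio := by
      have := silverRatio_pos
      positivity
    simpa [silverSchedule_succ, or_imp, forall_and] using ⟨ih, hmiddle, ih⟩

theorem IsInterpolable.hasPotentialBound_silverSchedule {E : Type*} [NormedAddCommGroup E]
    [InnerProductSpace ℝ E] {f : E → ℝ} {g : E → E} (hfg : IsInterpolable f g) (m : ℕ) :
    HasPotentialBound f g (silverSchedule m) := by
  have hρ := silverRatio_pos
  induction m with
  | zero => intro x _ y; simp [silverSchedule]
  | succ m ih =>
    rw [silverSchedule_succ]
    refine ih.append_singleton_append hfg silverRatio_sq hρ.le (by positivity) ?_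
    rw [sum_silverSchedule_add_one, mul_div_cancel₀ _ hρ.ne']

end Silver

section Rates

open scoped Gradient

variable {E : Type*} [NormedAddCommGroup E] [InnerProductSpace ℝ E] [CompleteSpace E]
  {L : ℝ} {h : E → ℝ} {α : List ℝ} {x₀ xstar : E} {x : ℕ → E}

theorem IsGradientDescentFrom.isDescentPath (hx : IsGradientDescentFrom L h α x₀ x) :
    IsDescentPath (fun z => L⁻¹ • ∇ h z) α x := by
  intro k hk
  rw [hx.2 k hk, smul_smul, div_eq_mul_inv]

theorem HasLipschitzGradient.silver_value_rate (hh : HasLipschitzGradient L h) (hL : 0 < L)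
    (hconv : ConvexOn ℝ Set.univ h) (hmin : IsMinOn h Set.univ xstar) {m : ℕ}
    (hx : IsGradientDescentFrom L h (silverSchedule m) x₀ x) :
    h (x (2 ^ m - 1)) - h xstar
      ≤ L * ‖x₀ - xstar‖ ^ 2 / (2 * (2 * (silverSchedule m).sum + 1)) := by
  have hfg := hh.isInterpolable hL hconv
  have hsum := sum_silverSchedule_nonneg m
  have hstationary : ∇ h xstar = 0 :=
    gradient_eq_zero_of_isLocalMin (hmin.isLocalMin Filter.univ_mem)
  have hrate := (hfg.hasPotentialBound_silverSchedule m).value_rate hfg hsum hx.isDescentPath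
    (y := xstar) (by simp only [hstationary, smul_zero])
  rw [silverSchedule_length, hx.1, ← mul_sub] at hrate
  rw [le_div_iff₀ (by positivity)]
  field_simp at hrate
  linarith

theorem HasLipschitzGradient.silver_gradient_rate (hh : HasLipschitzGradient L h) (hL : 0 < L)
    (hconv : ConvexOn ℝ Set.univ h) (hmin : IsMinOn h Set.univ xstar) {m : ℕ}
    (hx : IsGradientDescentFrom L h (silverSchedule m) x₀ x) :
    ‖∇ h (x (2 ^ m - 1))‖ ≤ L * ‖x₀ - xstar‖ / ((silverSchedule m).sum + 1) := by
  have hfg := hh.isInterpolable hL hconv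
  have hsum := sum_silverSchedule_nonneg m
  have hstationary : ∇ h xstar = 0 :=
    gradient_eq_zero_of_isLocalMin (hmin.isLocalMin Filter.univ_mem)
  have hrate := (hfg.hasPotentialBound_silverSchedule m).gradient_rate hfg hsum hx.isDescentPath
    (y := xstar) (by simp only [hstationary, smul_zero])
  rw [silverSchedule_length, hx.1, norm_smul, norm_inv, Real.norm_of_nonneg hL.le] at hrate
  rw [le_div_iff₀ (by positivity)]
  field_simp at hrate
  linarith

end Rates

section Huber

open scoped RealInnerProductSpace Gradient

variable {E : Type*} [NormedAddCommGroup E] [InnerProductSpace ℝ E] {δ τ c : ℝ}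

/-- The metric projection onto the closed ball of radius `δ` around the origin; it is the gradient
of the Huber function. -/
noncomputable def ballProjection (δ : ℝ) (v : E) : E :=
  if ‖v‖ ≤ δ then v else (δ / ‖v‖) • v

/-- The Huber function of the norm: `‖v‖ ^ 2 / 2` for `‖v‖ ≤ δ` and `δ * ‖v‖ - δ ^ 2 / 2` for
`δ ≤ ‖v‖`, written uniformly in terms of its gradient. -/
noncomputable def huber (δ : ℝ) (v : E) : ℝ :=
  ⟪ballProjection δ v, v⟫ - ‖ballProjection δ v‖ ^ 2 / 2

theorem norm_ballProjection_le (hδ : 0 ≤ δ) (v : E) : ‖ballProjection δ v‖ ≤ δ := by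
  unfold ballProjection
  split_ifs with hv
  · exact hv
  · have hpos : 0 < ‖v‖ := hδ.trans_lt (not_le.1 hv)
    rw [norm_smul, Real.norm_of_nonneg (by positivity), div_mul_cancel₀ _ hpos.ne']

theorem inner_sub_ballProjection_nonneg {u : E} (hu : ‖u‖ ≤ δ) (v : E) :
    0 ≤ ⟪v - ballProjection δ v, ballProjection δ v - u⟫ := by
  unfold ballProjection
  split_ifs with hv
  · rw [sub_self, inner_zero_left]
  · have hδ : 0 ≤ δ := (norm_nonneg u).trans hu
    have hpos : 0 < ‖v‖ := hδ.trans_lt (not_le.1 hv)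
    have hfactor : 0 ≤ 1 - δ / ‖v‖ := sub_nonneg.2 ((div_le_one hpos).2 (not_le.1 hv).le)
    have hinner : ⟪v, u⟫ ≤ δ / ‖v‖ * ‖v‖ ^ 2 := calc
      ⟪v, u⟫ ≤ ‖v‖ * ‖u‖ := real_inner_le_norm _ _
      _ ≤ ‖v‖ * δ := by gcongr
      _ = δ / ‖v‖ * ‖v‖ ^ 2 := by field_simp
    calc 0 ≤ (1 - δ / ‖v‖) * (δ / ‖v‖ * ‖v‖ ^ 2 - ⟪v, u⟫) :=
          mul_nonneg hfactor (sub_nonneg.2 hinner)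
      _ = ⟪v - (δ / ‖v‖) • v, (δ / ‖v‖) • v - u⟫ := by
          rw [show v - (δ / ‖v‖) • v = (1 - δ / ‖v‖) • v by module, real_inner_smul_left,
            inner_sub_right, real_inner_smul_right, real_inner_self_eq_norm_sq]

theorem isInterpolable_huber (hδ : 0 ≤ δ) :
    IsInterpolable (huber δ : E → ℝ) (ballProjection δ) := by
  intro x y
  have hproj := inner_sub_ballProjection_nonneg (norm_ballProjection_le hδ y) x
  rw [inner_sub_left, inner_sub_right, inner_sub_right, real_inner_self_eq_norm_sq,
    real_inner_comm _ x, real_inner_comm _ x] at hproj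
  rw [huber, huber, inner_sub_right, norm_sub_sq_real]
  linarith

theorem huber_zero (δ : ℝ) : huber δ (0 : E) = 0 := by
  simp [huber, ballProjection]

theorem huber_nonneg (hδ : 0 ≤ δ) (v : E) : 0 ≤ huber δ v := by
  simpa [huber_zero, ballProjection, hδ] using (isInterpolable_huber hδ).add_inner_le v 0

theorem ballProjection_smul (hτ : 0 ≤ τ) (hτc : τ ≤ c) (v : E) :
    ballProjection (τ * ‖v‖) (c • v) = τ • v := by
  have hc : 0 ≤ c := hτ.trans hτc
  rw [ballProjection, norm_smul, Real.norm_of_nonneg hc]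
  split_ifs with hv
  · have hzero : (c - τ) * ‖v‖ = 0 := by
      nlinarith [mul_nonneg (sub_nonneg.2 hτc) (norm_nonneg v)]
    rw [← sub_eq_zero, ← sub_smul, ← norm_eq_zero, norm_smul,
      Real.norm_of_nonneg (sub_nonneg.2 hτc), hzero]
  · have hpos : 0 < c * ‖v‖ := (by positivity : 0 ≤ τ * ‖v‖).trans_lt (not_le.1 hv)
    have hc' : c ≠ 0 := left_ne_zero_of_mul hpos.ne'
    have hv' : ‖v‖ ≠ 0 := right_ne_zero_of_mul hpos.ne'
    rw [smul_smul]
    congr 1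
    field_simp

theorem huber_smul (hτ : 0 ≤ τ) (hτc : τ ≤ c) (v : E) :
    huber (τ * ‖v‖) (c • v) = (τ * c - τ ^ 2 / 2) * ‖v‖ ^ 2 := by
  rw [huber, ballProjection_smul hτ hτc, real_inner_smul_left, real_inner_smul_right,
    real_inner_self_eq_norm_sq, norm_smul, mul_pow, Real.norm_eq_abs, sq_abs]
  ring

/- The threshold `τ * ‖x₀ - xstar‖` is so small that the iterates never leave the region where the
Huber function is linear along the ray from `xstar` through `x₀`. -/
theorem exists_isGradientDescentFrom_huber [CompleteSpace E] {L : ℝ} (hL : 0 < L) {l : List ℝ}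
    (hl : ∀ a ∈ l, 0 ≤ a) (hτ : 0 ≤ τ) (hτl : (l.sum + 1) * τ ≤ 1) (xstar x₀ : E) :
    ∃ (h : E → ℝ) (x : ℕ → E),
      ConvexOn ℝ Set.univ h ∧ HasLipschitzGradient L h ∧ IsMinOn h Set.univ xstar ∧
      IsGradientDescentFrom L h l x₀ x ∧
      h (x l.length) - h xstar
        = L * ((τ * (1 - l.sum * τ) - τ ^ 2 / 2) * ‖x₀ - xstar‖ ^ 2) ∧
      ‖∇ h (x l.length)‖ = L * (τ * ‖x₀ - xstar‖) := by
  set v := x₀ - xstar with hv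
  set δ := τ * ‖v‖
  have hδ : 0 ≤ δ := by positivity
  have hfg := (isInterpolable_huber (E := E) hδ).comp_sub_const xstar
  let h : E → ℝ := fun z => L * huber δ (z - xstar)
  let x : ℕ → E := fun k => xstar + (1 - (l.take k).sum * τ) • v
  have hfar (k : ℕ) : τ ≤ 1 - (l.take k).sum * τ := by
    linarith [mul_le_mul_of_nonneg_right ((List.take_sublist k l).sum_le_sum hl) hτ]
  have hgrad (k : ℕ) : ∇ h (x k) = (L * τ) • v := by
    rw [(hfg.hasGradientAt_const_mul L (x k)).gradient, add_sub_cancel_left,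
      ballProjection_smul hτ (hfar k), smul_smul]
  refine ⟨h, x, hfg.convexOn.smul hL.le, hfg.hasLipschitzGradient_const_mul hL.le,
    fun z _ => ?_, ⟨?_, fun k hk => ?_⟩, ?_, ?_⟩
  · change L * huber δ (xstar - xstar) ≤ L * huber δ (z - xstar)
    rw [sub_self, huber_zero]
    gcongr
    exact huber_nonneg hδ _
  · simp [x, hv]
  · rw [hgrad]
    simp only [x]
    rw [List.sum_take_succ l k hk, smul_smul,
      show l[k] / L * (L * τ) = l[k] * τ by field_simp]
    module
  · simp only [h, x]
    rw [add_sub_cancel_left, huber_smul hτ (hfar _), sub_self, huber_zero, List.take_length,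
      mul_zero, sub_zero]
  · rw [hgrad, norm_smul, Real.norm_of_nonneg (by positivity), mul_assoc]

theorem exists_value_gap_eq [CompleteSpace E] {L : ℝ} (hL : 0 < L) {l : List ℝ}
    (hl : ∀ a ∈ l, 0 ≤ a) (xstar x₀ : E) :
    ∃ (h : E → ℝ) (x : ℕ → E),
      ConvexOn ℝ Set.univ h ∧ HasLipschitzGradient L h ∧ IsMinOn h Set.univ xstar ∧
      IsGradientDescentFrom L h l x₀ x ∧
      h (x l.length) - h xstar = L * ‖x₀ - xstar‖ ^ 2 / (2 * (2 * l.sum + 1)) := by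
  have hsum : 0 ≤ l.sum := List.sum_nonneg hl
  have hτ : (l.sum + 1) * (2 * l.sum + 1)⁻¹ ≤ 1 := by
    rw [← div_eq_mul_inv, div_le_one (by positivity)]
    linarith
  obtain ⟨h, x, hconv, hsmooth, hmin, hx, hgap, -⟩ :=
    exists_isGradientDescentFrom_huber hL hl (by positivity) hτ xstar x₀
  refine ⟨h, x, hconv, hsmooth, hmin, hx, hgap.trans ?_⟩
  field_simp
  ring

theorem exists_norm_gradient_eq [CompleteSpace E] {L : ℝ} (hL : 0 < L) {l : List ℝ}
    (hl : ∀ a ∈ l, 0 ≤ a) (xstar x₀ : E) :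
    ∃ (h : E → ℝ) (x : ℕ → E),
      ConvexOn ℝ Set.univ h ∧ HasLipschitzGradient L h ∧ IsMinOn h Set.univ xstar ∧
      IsGradientDescentFrom L h l x₀ x ∧
      ‖∇ h (x l.length)‖ = L * ‖x₀ - xstar‖ / (l.sum + 1) := by
  have hsum : 0 ≤ l.sum := List.sum_nonneg hl
  obtain ⟨h, x, hconv, hsmooth, hmin, hx, -, hnorm⟩ :=
    exists_isGradientDescentFrom_huber hL hl (by positivity : 0 ≤ (l.sum + 1)⁻¹)
      (mul_inv_cancel₀ (by positivity)).le xstar x₀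
  refine ⟨h, x, hconv, hsmooth, hmin, hx, hnorm.trans ?_⟩
  ring

end Huber

theorem mainTheorem1_general {E : Type*} [NormedAddCommGroup E] [InnerProductSpace ℝ E]
    [CompleteSpace E] (m : ℕ) {L : ℝ} (hL : 0 < L) :
    (∀ (h : E → ℝ) (xstar x₀ : E) (x : ℕ → E),
        ConvexOn ℝ Set.univ h → HasLipschitzGradient L h → IsMinOn h Set.univ xstar →
        IsGradientDescentFrom L h (silverSchedule m) x₀ x →
        (h (x (2 ^ m - 1)) - h xstar
            ≤ L * ‖x₀ - xstar‖ ^ 2 / (2 * (2 * (silverSchedule m).sum + 1)) ∧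
          L * ‖x₀ - xstar‖ ^ 2 / (2 * (2 * (silverSchedule m).sum + 1))
            = L * ‖x₀ - xstar‖ ^ 2 / (4 * silverRatio ^ m - 2)) ∧
        (‖gradient h (x (2 ^ m - 1))‖
            ≤ L * ‖x₀ - xstar‖ / ((silverSchedule m).sum + 1) ∧
          L * ‖x₀ - xstar‖ / ((silverSchedule m).sum + 1)
            = L * ‖x₀ - xstar‖ / silverRatio ^ m)) ∧
    (∀ xstar x₀ : E,
        ∃ (h : E → ℝ) (x : ℕ → E),
          ConvexOn ℝ Set.univ h ∧ HasLipschitzGradient L h ∧ IsMinOn h Set.univ xstar ∧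
          IsGradientDescentFrom L h (silverSchedule m) x₀ x ∧
          h (x (2 ^ m - 1)) - h xstar = L * ‖x₀ - xstar‖ ^ 2 / (4 * silverRatio ^ m - 2)) ∧
    (∀ xstar x₀ : E,
        ∃ (h : E → ℝ) (x : ℕ → E),
          ConvexOn ℝ Set.univ h ∧ HasLipschitzGradient L h ∧ IsMinOn h Set.univ xstar ∧
          IsGradientDescentFrom L h (silverSchedule m) x₀ x ∧
          ‖gradient h (x (2 ^ m - 1))‖ = L * ‖x₀ - xstar‖ / silverRatio ^ m) := by
  have hpow := sum_silverSchedule_add_one m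
  have hvalue : 2 * (2 * (silverSchedule m).sum + 1) = 4 * silverRatio ^ m - 2 := by
    linear_combination 4 * hpow
  refine ⟨fun h xstar x₀ x hconv hh hmin hx => ⟨⟨?_, by rw [hvalue]⟩, ?_, by rw [hpow]⟩,
    fun xstar x₀ => ?_, fun xstar x₀ => ?_⟩
  · exact hh.silver_value_rate hL hconv hmin hx
  · exact hh.silver_gradient_rate hL hconv hmin hx
  · rw [← hvalue, ← silverSchedule_length]
    exact exists_value_gap_eq hL (silverSchedule_nonneg m) xstar x₀
  · rw [← hpow, ← silverSchedule_length]
    exact exists_norm_gradient_eq hL (silverSchedule_nonneg m) xstar x₀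

theorem mainTheorem1 (m : ℕ) (hm : 1 ≤ m) (d : ℕ) (L : ℝ) (hL : 0 < L) :
    -- the two convergence rates
    (∀ (h : EuclideanSpace ℝ (Fin d) → ℝ) (xstar x₀ : EuclideanSpace ℝ (Fin d))
        (x : ℕ → EuclideanSpace ℝ (Fin d)),
        ConvexOn ℝ Set.univ h → IsLSmooth L h → IsMinOn h Set.univ xstar →
        IsGradientDescent L h (silverSchedule m) x₀ x →
        (h (x (2 ^ m - 1)) - h xstar
            ≤ L * ‖x₀ - xstar‖ ^ 2 / (2 * (2 * (silverSchedule m).sum + 1)) ∧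
          L * ‖x₀ - xstar‖ ^ 2 / (2 * (2 * (silverSchedule m).sum + 1))
            = L * ‖x₀ - xstar‖ ^ 2 / (4 * silverRatio ^ m - 2)) ∧
        (‖gradient h (x (2 ^ m - 1))‖
            ≤ L * ‖x₀ - xstar‖ / ((silverSchedule m).sum + 1) ∧
          L * ‖x₀ - xstar‖ / ((silverSchedule m).sum + 1)
            = L * ‖x₀ - xstar‖ / silverRatio ^ m)) ∧
    -- tightness of the first rate
    (∀ xstar x₀ : EuclideanSpace ℝ (Fin d), x₀ ≠ xstar →
        ∃ (h : EuclideanSpace ℝ (Fin d) → ℝ) (x : ℕ → EuclideanSpace ℝ (Fin d)),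
          ConvexOn ℝ Set.univ h ∧ IsLSmooth L h ∧ IsMinOn h Set.univ xstar ∧
          IsGradientDescent L h (silverSchedule m) x₀ x ∧
          h (x (2 ^ m - 1)) - h xstar = L * ‖x₀ - xstar‖ ^ 2 / (4 * silverRatio ^ m - 2)) ∧
    -- tightness of the second rate
    (∀ xstar x₀ : EuclideanSpace ℝ (Fin d), x₀ ≠ xstar →
        ∃ (h : EuclideanSpace ℝ (Fin d) → ℝ) (x : ℕ → EuclideanSpace ℝ (Fin d)),
          ConvexOn ℝ Set.univ h ∧ IsLSmooth L h ∧ IsMinOn h Set.univ xstar ∧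
          IsGradientDescent L h (silverSchedule m) x₀ x ∧
          ‖gradient h (x (2 ^ m - 1))‖ = L * ‖x₀ - xstar‖ / silverRatio ^ m) :=
  have ⟨rates, value_tight, gradient_tight⟩ := mainTheorem1_general m hL
  ⟨rates, fun xstar x₀ _ => value_tight xstar x₀, fun xstar x₀ _ => gradient_tight xstar x₀⟩
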